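/- Let $N\ge 1$ and let $\Omega\subseteq\mathbb R^N$ be open. For $E\subseteq\Omega$ let $$\operatorname{cap}(E)=\inf\{\|z\|^2_{H^1(\Omega)} : z\in H^1_0(\Omega),\ z\ge 1 \text{ a.e. in a neighbourhood of } E\}\in[0,\infty],$$ where $\|z\|^2_{H^1(\Omega)}=\int_\Omega(|z|^2+|\nabla z|^2)\,dx$ and the infimum of the empty set is $\infty$. A property holds quasi everywhere in $\Omega$ if it holds outside a set of capacity zero. A function $\psi:\Omega\to[-\infty,+\infty]$ is quasi upper semicontinuous if for every $\varepsilon>0$ there is a set $E\subseteq\Omega$ with $\operatorname{cap}(E)<\varepsilon$ such that the restriction $\psi|_{\Omega\setminus E}$ is upper semicontinuous. For quasi upper semicontinuous functions $\psi_n,\psi:\Omega\to[-\infty,+\infty]$ $(n\in\mathbb N)$, we say that $\psi_n$ converges to $\psi$ in the sense of level sets if $$\operatorname{cap}(\{\psi>t\}\cap B)\le\liminf_{n\to\infty}\operatorname{cap}(\{\psi_n>s\}\cap B')\quad\text{and}\quad\limsup_{n\to\infty}\operatorname{cap}(\{\psi_n>t\}\cap B)\le\operatorname{cap}(\{\psi>s\}\cap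 B')$$ for all real $s<t$ and all sets $B\subset\subset B'\subset\subset\Omega$, where $B\subset\subset B'$ means that the closure of $B$ is compact and contained in the interior of $B'$. Let $\psi_n$ $(n\in\mathbb N)$, $\psi$ and $\varphi$ be quasi upper semicontinuous functions from $\Omega$ to $[-\infty,+\infty]$. If $\psi_n$ converges in the sense of level sets both to $\psi$ and to $\varphi$, then $\psi=\varphi$ quasi everywhere in $\Omega$. -/

import Mathlib

open MeasureTheory Filter Topology Set
open scoped ENNReal ContDiff Gradient

namespace LevelSetConv

/-- Test functions on `Ω`, i.e. the elements of `C_c^∞(Ω)` (extended by zero). -/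
structure IsTestFunction {N : ℕ} (Ω : Set (EuclideanSpace ℝ (Fin N)))
    (η : EuclideanSpace ℝ (Fin N) → ℝ) : Prop where
  smooth : ContDiff ℝ ∞ η
  compact : HasCompactSupport η
  support : tsupport η ⊆ Ω

/-- `u ∈ H¹(Ω)`, with weak gradient `g`: both are square integrable on `Ω`, and
`∫_Ω u ∇η = - ∫_Ω η g` for all test functions `η`. The function `g` is determined by `u` up to
equality almost everywhere in `Ω`. -/
structure MemH1 {N : ℕ} (Ω : Set (EuclideanSpace ℝ (Fin N)))
    (u : EuclideanSpace ℝ (Fin N) → ℝ)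
    (g : EuclideanSpace ℝ (Fin N) → EuclideanSpace ℝ (Fin N)) : Prop where
  memLp : MemLp u 2 (volume.restrict Ω)
  memLp_grad : MemLp g 2 (volume.restrict Ω)
  weak_grad : ∀ η : EuclideanSpace ℝ (Fin N) → ℝ, IsTestFunction Ω η →
    ∫ x in Ω, u x • ∇ η x = - ∫ x in Ω, η x • g x

/-- The squared norm `‖u‖²_{H¹(Ω)} = ∫_Ω (|u|² + |g|²)` of a function `u` with weak gradient `g`. -/
noncomputable def h1NormSq {N : ℕ} (Ω : Set (EuclideanSpace ℝ (Fin N)))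
    (u : EuclideanSpace ℝ (Fin N) → ℝ)
    (g : EuclideanSpace ℝ (Fin N) → EuclideanSpace ℝ (Fin N)) : ℝ≥0∞ :=
  ∫⁻ x in Ω, (‖u x‖ₑ ^ 2 + ‖g x‖ₑ ^ 2)

/-- `u ∈ H¹₀(Ω)`, with weak gradient `g`: the function `u` is in `H¹(Ω)` and is the limit, in the
norm of `H¹(Ω)`, of a sequence of test functions. -/
structure MemH10 {N : ℕ} (Ω : Set (EuclideanSpace ℝ (Fin N)))
    (u : EuclideanSpace ℝ (Fin N) → ℝ)
    (g : EuclideanSpace ℝ (Fin N) → EuclideanSpace ℝ (Fin N)) : Prop extends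
    MemH1 Ω u g where
  approx : ∃ η : ℕ → EuclideanSpace ℝ (Fin N) → ℝ, (∀ k, IsTestFunction Ω (η k)) ∧
    Tendsto (fun k => h1NormSq Ω (fun x => u x - η k x) (fun x => g x - ∇ (η k) x)) atTop (𝓝 0)

/-- The capacity of `E` with respect to `Ω`: the infimum of `‖z‖²_{H¹(Ω)}` over all `z ∈ H¹₀(Ω)`
with `z ≥ 1` almost everywhere in a neighbourhood (in `Ω`) of `E`. The infimum of the empty set
is `∞`. -/
noncomputable def cap {N : ℕ} (Ω E : Set (EuclideanSpace ℝ (Fin N))) : ℝ≥0∞ :=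
  sInf {c : ℝ≥0∞ | ∃ z g, MemH10 Ω z g ∧
    (∃ U, IsOpen U ∧ E ⊆ U ∧ U ⊆ Ω ∧ ∀ᵐ x ∂(volume.restrict U), 1 ≤ z x) ∧
    c = h1NormSq Ω z g}

/-- The functions `ψ : Ω → [-∞, +∞]` are given as functions on the whole space, of which only the
values on `Ω` matter. `ψ` is quasi upper semicontinuous if for every `ε > 0` its restriction to
`Ω \ E` is upper semicontinuous, for some `E ⊆ Ω` with `cap E < ε`. -/
def QuasiUSC {N : ℕ} (Ω : Set (EuclideanSpace ℝ (Fin N)))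
    (ψ : EuclideanSpace ℝ (Fin N) → EReal) : Prop :=
  ∀ ε : ℝ≥0∞, 0 < ε → ∃ E ⊆ Ω, cap Ω E < ε ∧ UpperSemicontinuousOn ψ (Ω \ E)

/-- The superlevel set `{ψ > t} = {x ∈ Ω | ψ x > t}`. -/
def superlevel {N : ℕ} (Ω : Set (EuclideanSpace ℝ (Fin N)))
    (ψ : EuclideanSpace ℝ (Fin N) → EReal) (t : ℝ) : Set (EuclideanSpace ℝ (Fin N)) :=
  {x ∈ Ω | (t : EReal) < ψ x}

/-- `B ⊂⊂ B'`: the closure of `B` is compact and contained in the interior of `B'`. -/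
def CompactlyIn {N : ℕ} (B B' : Set (EuclideanSpace ℝ (Fin N))) : Prop :=
  IsCompact (closure B) ∧ closure B ⊆ interior B'

/-- `ψ n` tends to `ψ` in the sense of level sets in `Ω`. -/
def LevTendsto {N : ℕ} (Ω : Set (EuclideanSpace ℝ (Fin N)))
    (ψn : ℕ → EuclideanSpace ℝ (Fin N) → EReal) (ψ : EuclideanSpace ℝ (Fin N) → EReal) : Prop :=
  ∀ s t : ℝ, s < t → ∀ B B' : Set (EuclideanSpace ℝ (Fin N)),
    CompactlyIn B B' → CompactlyIn B' Ω →
    cap Ω (superlevel Ω ψ t ∩ B) ≤ liminf (fun n => cap Ω (superlevel Ω (ψn n) s ∩ B')) atTop ∧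
    limsup (fun n => cap Ω (superlevel Ω (ψn n) t ∩ B)) atTop ≤ cap Ω (superlevel Ω ψ s ∩ B')

end LevelSetConv

/-!
Fix reals `s < t`. Passing through the superlevel sets of the sequence at a level between `s` and
`t`, both kinds of convergence give `cap ({ψ > t} ∩ K) ≤ cap ({φ > s} ∩ U)` for `K` compact in an
open set `U ⊆ Ω` (`cap_superlevel_inter_le`). Let `E` be a set of small capacity off which `φ` is
upper semicontinuous. The set `{φ < s}` is contained, up to `E`, in an open set `U` on which
`φ < s` holds off `E`. So `{φ > s} ∩ U ⊆ E`, and `{ψ > t} ∩ K` has capacity at most `cap E` for all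
compact sets `K ⊆ U`. Since the capacity is continuous along increasing sequences of arbitrary
sets, the same holds for `{ψ > t} ∩ U`, and `{ψ > t, φ < s}` has capacity at most `2 cap E`, thus
zero. Countable subadditivity, applied to all rational `s < t`, shows `ψ ≤ φ` quasi everywhere, and
the roles of `ψ` and `φ` can be exchanged.

The work lies in the properties of the capacity: it is subadditive (`cap_union_le`), and continuous
along increasing sequences (`cap_iUnion_le_of_monotone`). Here `H¹₀(Ω)` is treated as a closed
subspace `sobolevZero Ω` of the Hilbert space of square integrable pairs `(u, ∇u)`. With each `u`
it contains `|u|`, with no larger norm (`exists_abs_mem_sobolevZero`): the functions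
`√(η² + ε²) - ε` approximate `|u|` in `L²`, and their norms are controlled. The parallelogram
identity turns this into `‖max u v‖² + ‖min u v‖² ≤ ‖u‖² + ‖v‖²`, hence into
strong subadditivity. Limits of bounded sequences are found by the principle that decreasing
sequences of bounded nonempty closed convex sets intersect (`nonempty_iInter_of_antitone_convex`).
-/

namespace LevelSetConv

/-! ### Nested convex sets in a Hilbert space -/

/-- In a Hilbert space, a decreasing sequence of nonempty bounded closed convex sets has a common
point. The elements of least norm form a Cauchy sequence, which avoids weak compactness. -/
theorem nonempty_iInter_of_antitone_convex {H : Type*} [NormedAddCommGroup H]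
    [InnerProductSpace ℝ H] [CompleteSpace H] {K : ℕ → Set H} (hanti : Antitone K)
    (hclosed : ∀ n, IsClosed (K n)) (hconv : ∀ n, Convex ℝ (K n)) (hne : ∀ n, (K n).Nonempty)
    {c : ℝ} (hbdd : ∀ n, ∀ x ∈ K n, ‖x‖ ≤ c) : (⋂ n, K n).Nonempty := by
  have hmin : ∀ n, ∃ x ∈ K n, ∀ y ∈ K n, ‖y - x‖ ^ 2 ≤ ‖y‖ ^ 2 - ‖x‖ ^ 2 := by
    intro n
    obtain ⟨x, hx, hx'⟩ := exists_norm_eq_iInf_of_complete_convex (hne n)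
      (hclosed n).isComplete (hconv n) (0 : H)
    refine ⟨x, hx, fun y hy => ?_⟩
    have h := (norm_eq_iInf_iff_real_inner_le_zero (hconv n) hx).1 hx' y hy
    have h1 : ‖y‖ ^ 2 = ‖x‖ ^ 2 + 2 * inner ℝ x (y - x) + ‖y - x‖ ^ 2 := by
      rw [← norm_add_sq_real, add_sub_cancel]
    rw [zero_sub, inner_neg_left] at h
    linarith
  choose x hxK hx using hmin
  have hle : ∀ m n, m ≤ n → ‖x n - x m‖ ^ 2 ≤ ‖x n‖ ^ 2 - ‖x m‖ ^ 2 :=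
    fun m n hmn => hx m _ (hanti hmn (hxK n))
  have hmono : Monotone fun n => ‖x n‖ ^ 2 := fun m n hmn => by
    have := hle m n hmn
    have := sq_nonneg ‖x n - x m‖
    simp only
    linarith
  have hbd : BddAbove (range fun n => ‖x n‖ ^ 2) := by
    refine ⟨c ^ 2, ?_⟩
    rintro _ ⟨n, rfl⟩
    exact pow_le_pow_left₀ (norm_nonneg _) (hbdd n _ (hxK n)) 2
  have hcauchy : CauchySeq x := by
    have ht := (tendsto_atTop_ciSup hmono hbd).cauchySeq
    rw [Metric.cauchySeq_iff] at ht ⊢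
    intro ε hε
    obtain ⟨M, hM⟩ := ht (ε ^ 2) (by positivity)
    have key : ∀ m ≥ M, ∀ n, m ≤ n → dist (x n) (x m) < ε := by
      intro m hm n hmn
      have h1 := hM n (hm.trans hmn) m hm
      rw [Real.dist_eq] at h1
      rw [dist_eq_norm]
      exact lt_of_pow_lt_pow_left₀ 2 hε.le
        ((hle m n hmn).trans_lt ((le_abs_self _).trans_lt h1))
    refine ⟨M, fun m hm n hn => ?_⟩
    rcases le_total m n with h | h
    · rw [dist_comm]
      exact key m hm n h
    · exact key n hn m h
  obtain ⟨y, hy⟩ := cauchySeq_tendsto_of_complete hcauchy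
  exact ⟨y, mem_iInter.2 fun n => (hclosed n).mem_of_tendsto hy
    ((eventually_ge_atTop n).mono fun m hm => hanti hm (hxK m))⟩

/-! ### The Hilbert space of functions paired with gradients -/

variable {N : ℕ} {Ω : Set (EuclideanSpace ℝ (Fin N))}

/-- The target of pairs (function, gradient), with its Euclidean norm. -/
abbrev Jet (N : ℕ) : Type := WithLp 2 (ℝ × EuclideanSpace ℝ (Fin N))

/-- Square integrable pairs (function, gradient) on `Ω`. The norm is that of `H¹(Ω)`. -/
abbrev JetL2 (Ω : Set (EuclideanSpace ℝ (Fin N))) : Type := Lp (Jet N) 2 (volume.restrict Ω)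

/-- The pair of a function `u` and a vector field `g`. -/
def jet (u : EuclideanSpace ℝ (Fin N) → ℝ)
    (g : EuclideanSpace ℝ (Fin N) → EuclideanSpace ℝ (Fin N)) :
    EuclideanSpace ℝ (Fin N) → Jet N :=
  fun x => WithLp.toLp 2 (u x, g x)

theorem enorm_jet_sq (u : EuclideanSpace ℝ (Fin N) → ℝ)
    (g : EuclideanSpace ℝ (Fin N) → EuclideanSpace ℝ (Fin N)) (x : EuclideanSpace ℝ (Fin N)) :
    ‖jet u g x‖ₑ ^ 2 = ‖u x‖ₑ ^ 2 + ‖g x‖ₑ ^ 2 := by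
  have h := WithLp.prod_norm_sq_eq_of_L2 (jet u g x)
  simp only [← ofReal_norm]
  rw [← ENNReal.ofReal_pow (norm_nonneg _), ← ENNReal.ofReal_pow (norm_nonneg _),
    ← ENNReal.ofReal_pow (norm_nonneg _), ← ENNReal.ofReal_add (by positivity) (by positivity), h]
  rfl

theorem h1NormSq_eq_eLpNorm (u : EuclideanSpace ℝ (Fin N) → ℝ)
    (g : EuclideanSpace ℝ (Fin N) → EuclideanSpace ℝ (Fin N)) :
    h1NormSq Ω u g = eLpNorm (jet u g) 2 (volume.restrict Ω) ^ 2 := by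
  have h := eLpNorm_nnreal_pow_eq_lintegral (p := 2) (f := jet u g) (μ := volume.restrict Ω)
    (by norm_num)
  norm_num at h
  rw [h, h1NormSq]
  exact lintegral_congr fun x => (enorm_jet_sq u g x).symm

theorem memLp_jet {μ : Measure (EuclideanSpace ℝ (Fin N))} {u : EuclideanSpace ℝ (Fin N) → ℝ}
    {g : EuclideanSpace ℝ (Fin N) → EuclideanSpace ℝ (Fin N)} (hu : MemLp u 2 μ)
    (hg : MemLp g 2 μ) : MemLp (jet u g) 2 μ := by
  have hm : AEStronglyMeasurable (jet u g) μ :=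
    (WithLp.prodContinuousLinearEquiv 2 ℝ ℝ
      (EuclideanSpace ℝ (Fin N))).symm.continuous.comp_aestronglyMeasurable (hu.1.prodMk hg.1)
  rw [memLp_two_iff_integrable_sq_norm hm]
  have h := ((memLp_two_iff_integrable_sq_norm hu.1).1 hu).add
    ((memLp_two_iff_integrable_sq_norm hg.1).1 hg)
  refine h.congr (Eventually.of_forall fun x => ?_)
  exact (WithLp.prod_norm_sq_eq_of_L2 (jet u g x)).symm

theorem memLp_fst (f : JetL2 Ω) : MemLp (fun x => (f x).fst) 2 (volume.restrict Ω) :=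
  (WithLp.fstL 2 ℝ ℝ (EuclideanSpace ℝ (Fin N))).comp_memLp f

theorem memLp_snd (f : JetL2 Ω) : MemLp (fun x => (f x).snd) 2 (volume.restrict Ω) :=
  (WithLp.sndL 2 ℝ ℝ (EuclideanSpace ℝ (Fin N))).comp_memLp f

/-- The function component of a pair, as a continuous linear map. -/
noncomputable def fstLp (Ω : Set (EuclideanSpace ℝ (Fin N))) :
    JetL2 Ω →L[ℝ] Lp ℝ 2 (volume.restrict Ω) :=
  (WithLp.fstL 2 ℝ ℝ (EuclideanSpace ℝ (Fin N))).compLpL 2 (volume.restrict Ω)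

theorem coeFn_fstLp (f : JetL2 Ω) : fstLp Ω f =ᵐ[volume.restrict Ω] fun x => (f x).fst :=
  (WithLp.fstL 2 ℝ ℝ (EuclideanSpace ℝ (Fin N))).coeFn_compLpL f

theorem h1NormSq_eq_enorm_sq {f : JetL2 Ω} {u : EuclideanSpace ℝ (Fin N) → ℝ}
    {g : EuclideanSpace ℝ (Fin N) → EuclideanSpace ℝ (Fin N)}
    (hf : f =ᵐ[volume.restrict Ω] jet u g) : h1NormSq Ω u g = ‖f‖ₑ ^ 2 := by
  rw [h1NormSq_eq_eLpNorm, ← eLpNorm_congr_ae hf, Lp.enorm_def]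

/-! ### Test functions -/

theorem inner_gradient_eq_fderiv {η : EuclideanSpace ℝ (Fin N) → ℝ}
    (x v : EuclideanSpace ℝ (Fin N)) : inner ℝ (∇ η x) v = fderiv ℝ η x v := by
  rw [gradient, InnerProductSpace.toDual_symm_apply]

namespace IsTestFunction

variable {η ζ : EuclideanSpace ℝ (Fin N) → ℝ}

theorem continuous_gradient (hη : IsTestFunction Ω η) : Continuous (∇ η) :=
  (InnerProductSpace.toDual ℝ _).symm.continuous.comp
    (hη.smooth.continuous_fderiv (by simp))

theorem hasCompactSupport_gradient (hη : IsTestFunction Ω η) : HasCompactSupport (∇ η) :=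
  (hη.compact.fderiv ℝ).comp_left (map_zero _)

theorem memLp {μ : Measure (EuclideanSpace ℝ (Fin N))} [IsFiniteMeasureOnCompacts μ]
    (hη : IsTestFunction Ω η) : MemLp η 2 μ :=
  hη.smooth.continuous.memLp_of_hasCompactSupport hη.compact

theorem memLp_gradient {μ : Measure (EuclideanSpace ℝ (Fin N))} [IsFiniteMeasureOnCompacts μ]
    (hη : IsTestFunction Ω η) : MemLp (∇ η) 2 μ :=
  hη.continuous_gradient.memLp_of_hasCompactSupport hη.hasCompactSupport_gradient

theorem differentiable (hη : IsTestFunction Ω η) : Differentiable ℝ η :=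
  hη.smooth.differentiable (by simp)

theorem zero : IsTestFunction Ω (0 : EuclideanSpace ℝ (Fin N) → ℝ) :=
  ⟨contDiff_const, HasCompactSupport.zero, by simp⟩

theorem add (hη : IsTestFunction Ω η) (hζ : IsTestFunction Ω ζ) : IsTestFunction Ω (η + ζ) :=
  ⟨hη.smooth.add hζ.smooth, hη.compact.add hζ.compact,
    (tsupport_add η ζ).trans (union_subset hη.support hζ.support)⟩

theorem smul (c : ℝ) (hη : IsTestFunction Ω η) : IsTestFunction Ω (c • η) :=
  ⟨contDiff_const.smul hη.smooth, hη.compact.smul_left (f := fun _ => c),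
    (closure_mono (Function.support_const_smul_subset c η)).trans hη.support⟩

/-- Integration by parts between two test functions. -/
theorem integral_mul_fderiv (hη : IsTestFunction Ω η) (hζ : IsTestFunction Ω ζ)
    (v : EuclideanSpace ℝ (Fin N)) :
    ∫ x in Ω, (η x * fderiv ℝ ζ x v + ζ x * fderiv ℝ η x v) = 0 := by
  have hc : ∀ {a b : EuclideanSpace ℝ (Fin N) → ℝ}, IsTestFunction Ω a → IsTestFunction Ω b →
      Integrable (fun x => a x * fderiv ℝ b x v) := fun ha hb =>
    (ha.smooth.continuous.mul ((hb.smooth.continuous_fderiv (by simp)).clm_apply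
      continuous_const)).integrable_of_hasCompactSupport ha.compact.mul_right
  rw [setIntegral_eq_integral_of_forall_compl_eq_zero, integral_add (hc hη hζ) (hc hζ hη),
    integral_mul_fderiv_eq_neg_fderiv_mul_of_integrable]
  · simp_rw [mul_comm (ζ _)]
    simp
  · simpa only [mul_comm] using hc hζ hη
  · exact hc hη hζ
  · exact (hη.smooth.continuous.mul hζ.smooth.continuous).integrable_of_hasCompactSupport
      hη.compact.mul_right
  · exact fun x _ => hη.differentiable x
  · exact fun x _ => hζ.differentiable x
  · intro x hx
    rw [image_eq_zero_of_notMem_tsupport fun h => hx (hη.support h),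
      image_eq_zero_of_notMem_tsupport fun h => hx (hζ.support h)]
    simp

end IsTestFunction

/-- The pairs `(η, ∇ η)` of test functions `η`. -/
noncomputable def testJets (Ω : Set (EuclideanSpace ℝ (Fin N))) : Submodule ℝ (JetL2 Ω) where
  carrier := {f | ∃ η, IsTestFunction Ω η ∧ f =ᵐ[volume.restrict Ω] jet η (∇ η)}
  zero_mem' := by
    refine ⟨0, IsTestFunction.zero, (Lp.coeFn_zero _ _ _).trans (Eventually.of_forall fun x => ?_)⟩
    simp only [jet, Pi.zero_apply]
    have : ∇ (0 : EuclideanSpace ℝ (Fin N) → ℝ) x = 0 := gradient_const x 0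
    rw [this]
    rfl
  add_mem' := by
    rintro f h ⟨η, hη, hf⟩ ⟨ζ, hζ, hh⟩
    refine ⟨η + ζ, hη.add hζ, ?_⟩
    filter_upwards [Lp.coeFn_add f h, hf, hh] with x h1 h2 h3
    rw [h1, Pi.add_apply, h2, h3]
    have : ∇ (η + ζ) x = ∇ η x + ∇ ζ x := by
      simp [gradient, fderiv_add (hη.differentiable x) (hζ.differentiable x)]
    simp only [jet, Pi.add_apply, this]
    rfl
  smul_mem' := by
    rintro c f ⟨η, hη, hf⟩
    refine ⟨c • η, hη.smul c, ?_⟩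
    filter_upwards [Lp.coeFn_smul c f, hf] with x h1 h2
    rw [h1, Pi.smul_apply, h2]
    have : ∇ (c • η) x = c • ∇ η x := by
      simp [gradient, fderiv_const_smul (hη.differentiable x)]
    simp only [jet, Pi.smul_apply, this]
    rfl

/-- `H¹₀(Ω)` as a closed subspace of the Hilbert space of pairs. -/
noncomputable def sobolevZero (Ω : Set (EuclideanSpace ℝ (Fin N))) : Submodule ℝ (JetL2 Ω) :=
  (testJets Ω).topologicalClosure

theorem isClosed_sobolevZero : IsClosed (sobolevZero Ω : Set (JetL2 Ω)) :=
  (testJets Ω).isClosed_topologicalClosure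

/-- The elements of the closure satisfy the weak gradient identity, because it says that they are
orthogonal to certain square integrable pairs. -/
theorem integral_fst_mul_fderiv {f : JetL2 Ω} (hf : f ∈ sobolevZero Ω)
    {η : EuclideanSpace ℝ (Fin N) → ℝ} (hη : IsTestFunction Ω η) (v : EuclideanSpace ℝ (Fin N)) :
    ∫ x in Ω, ((f x).fst * fderiv ℝ η x v + η x * inner ℝ (f x).snd v) = 0 := by
  have hL : MemLp (jet (fun x => fderiv ℝ η x v) (fun x => η x • v)) 2 (volume.restrict Ω) := by
    refine memLp_jet ?_ ?_
    · refine ((hη.smooth.continuous_fderiv (by simp)).clm_apply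
        continuous_const).memLp_of_hasCompactSupport ?_
      exact (hη.compact.fderiv ℝ).comp_left (g := fun L => L v) rfl
    · exact (hη.smooth.continuous.smul continuous_const).memLp_of_hasCompactSupport
        hη.compact.smul_right
  set w : JetL2 Ω := hL.toLp with hw
  have hinner : ∀ h : JetL2 Ω, inner ℝ w h =
      ∫ x in Ω, ((h x).fst * fderiv ℝ η x v + η x * inner ℝ (h x).snd v) := by
    intro h
    rw [L2.inner_def]
    refine integral_congr_ae ?_
    filter_upwards [hL.coeFn_toLp] with x hx
    rw [hw, hx, WithLp.prod_inner_apply]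
    simp [jet, real_inner_smul_left, real_inner_comm]
  rw [← hinner]
  have hcl : IsClosed {h : JetL2 Ω | inner ℝ w h = 0} :=
    isClosed_eq (continuous_const.inner continuous_id) continuous_const
  refine closure_minimal ?_ hcl hf
  rintro h ⟨ζ, hζ, hh⟩
  rw [mem_ofPred_eq, hinner, ← hζ.integral_mul_fderiv hη v]
  refine integral_congr_ae ?_
  filter_upwards [hh] with x hx
  rw [hx, jet, WithLp.toLp_snd, WithLp.toLp_fst, inner_gradient_eq_fderiv]

theorem memH10_of_mem_sobolevZero {f : JetL2 Ω} (hf : f ∈ sobolevZero Ω) :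
    MemH10 Ω (fun x => (f x).fst) (fun x => (f x).snd) := by
  refine ⟨⟨memLp_fst f, memLp_snd f, fun η hη => ?_⟩, ?_⟩
  · have hη1 := hη.memLp (μ := volume.restrict Ω)
    have hη2 := hη.memLp_gradient (μ := volume.restrict Ω)
    have hi1 : Integrable (fun x => (f x).fst • ∇ η x) (volume.restrict Ω) :=
      memLp_one_iff_integrable.1 (hη2.smul (memLp_fst f))
    have hi2 : Integrable (fun x => η x • (f x).snd) (volume.restrict Ω) :=
      memLp_one_iff_integrable.1 ((memLp_snd f).smul hη1)
    rw [eq_neg_iff_add_eq_zero, ← integral_add hi1 hi2]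
    refine ext_inner_right ℝ fun v => ?_
    have hi := hi1.add hi2
    simp only [Pi.add_def] at hi
    rw [real_inner_comm, ← integral_inner hi, inner_zero_left,
      ← integral_fst_mul_fderiv hf hη v]
    refine integral_congr_ae (Eventually.of_forall fun x => ?_)
    simp only [inner_add_right, inner_smul_right]
    rw [real_inner_comm, inner_gradient_eq_fderiv, real_inner_comm]
  · have hf' : f ∈ closure (testJets Ω : Set (JetL2 Ω)) := hf
    obtain ⟨h, hh, hlim⟩ := mem_closure_iff_seq_limit.1 hf'
    choose η hη hhη using hh
    refine ⟨η, hη, ?_⟩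
    have key : ∀ k, h1NormSq Ω (fun x => (f x).fst - η k x) (fun x => (f x).snd - ∇ (η k) x) =
        ‖f - h k‖ₑ ^ 2 := by
      intro k
      refine h1NormSq_eq_enorm_sq ?_
      filter_upwards [Lp.coeFn_sub f (h k), hhη k] with x h1 h2
      rw [h1, Pi.sub_apply, h2]
      rfl
    simp_rw [key]
    have : Tendsto (fun k => ‖f - h k‖ₑ ^ 2) atTop (𝓝 (‖f - f‖ₑ ^ 2)) :=
      ((ENNReal.continuous_pow 2).comp continuous_enorm).continuousAt.tendsto.comp
        (tendsto_const_nhds.sub hlim)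
    simpa using this

/-- Together with `memH10_of_mem_sobolevZero`, this identifies `MemH10` with membership in the
closed subspace. -/
theorem MemH10.exists_mem_sobolevZero {u : EuclideanSpace ℝ (Fin N) → ℝ}
    {g : EuclideanSpace ℝ (Fin N) → EuclideanSpace ℝ (Fin N)} (hu : MemH10 Ω u g) :
    ∃ f ∈ sobolevZero Ω, f =ᵐ[volume.restrict Ω] jet u g := by
  have hL := memLp_jet hu.memLp hu.memLp_grad
  refine ⟨hL.toLp, ?_, hL.coeFn_toLp⟩
  obtain ⟨η, hη, hlim⟩ := hu.approx
  have hk : ∀ k, MemLp (jet (η k) (∇ (η k))) 2 (volume.restrict Ω) :=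
    fun k => memLp_jet (hη k).memLp (hη k).memLp_gradient
  refine mem_closure_of_tendsto (f := fun k => (hk k).toLp) (b := atTop) ?_
    (Eventually.of_forall fun k => ⟨η k, hη k, (hk k).coeFn_toLp⟩)
  have key : ∀ k, h1NormSq Ω (fun x => u x - η k x) (fun x => g x - ∇ (η k) x) =
      ‖hL.toLp - (hk k).toLp‖ₑ ^ 2 := by
    intro k
    refine h1NormSq_eq_enorm_sq ?_
    filter_upwards [Lp.coeFn_sub hL.toLp (hk k).toLp, hL.coeFn_toLp, (hk k).coeFn_toLp]
      with x h1 h2 h3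
    rw [h1, Pi.sub_apply, h2, h3]
    rfl
  simp_rw [key] at hlim
  -- Taking square roots turns the convergence of squared norms into convergence in norm.
  rw [tendsto_iff_edist_tendsto_0]
  have h2 := (ENNReal.continuous_rpow_const (y := 1 / 2)).continuousAt.tendsto.comp hlim
  refine (h2.congr fun k => ?_).trans (by simp)
  rw [Function.comp_apply, ← ENNReal.rpow_natCast, ← ENNReal.rpow_mul, edist_comm,
    edist_eq_enorm_sub]
  norm_num

/-! ### Absolute values and lattice operations in `H¹₀` -/

/-- A smooth approximation of the absolute value that vanishes at `0` and is `1`-Lipschitz. -/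
noncomputable def smoothAbs (ε a : ℝ) : ℝ := √(a ^ 2 + ε ^ 2) - ε

theorem smoothAbs_nonneg (ε a : ℝ) : 0 ≤ smoothAbs ε a :=
  sub_nonneg.2 (Real.le_sqrt_of_sq_le (by nlinarith [sq_nonneg a]))

theorem smoothAbs_le_abs {ε : ℝ} (hε : 0 < ε) (a : ℝ) : smoothAbs ε a ≤ |a| := by
  rw [smoothAbs, sub_le_iff_le_add]
  refine Real.sqrt_le_iff.2 ⟨by positivity, ?_⟩
  nlinarith [sq_abs a, mul_nonneg (abs_nonneg a) hε.le]

theorem abs_sub_smoothAbs_le (ε a : ℝ) : |a| - smoothAbs ε a ≤ ε := by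
  have : |a| ≤ √(a ^ 2 + ε ^ 2) :=
    Real.le_sqrt_of_sq_le (by nlinarith [sq_abs a, sq_nonneg ε])
  rw [smoothAbs]
  linarith

theorem smoothAbs_zero {ε : ℝ} (hε : 0 < ε) : smoothAbs ε 0 = 0 := by
  simp [smoothAbs, Real.sqrt_sq hε.le]

theorem contDiff_smoothAbs {ε : ℝ} (hε : 0 < ε) : ContDiff ℝ ∞ (smoothAbs ε) := by
  unfold smoothAbs
  refine ContDiff.sub (ContDiff.sqrt (by fun_prop) fun x => ?_) contDiff_const
  positivity

theorem exists_hasDerivAt_smoothAbs {ε : ℝ} (hε : 0 < ε) (a : ℝ) :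
    ∃ d : ℝ, |d| ≤ 1 ∧ HasDerivAt (smoothAbs ε) d a := by
  have hpos : 0 < a ^ 2 + ε ^ 2 := by positivity
  have h : HasDerivAt (fun a : ℝ => a ^ 2 + ε ^ 2) (2 * a) a := by
    simpa using (hasDerivAt_pow 2 a).add_const (ε ^ 2)
  refine ⟨2 * a / (2 * √(a ^ 2 + ε ^ 2)), ?_, (h.sqrt hpos.ne').sub_const ε⟩
  rw [mul_div_mul_left _ _ two_ne_zero, abs_div, abs_of_pos (Real.sqrt_pos.2 hpos)]
  exact div_le_one_of_le₀ (Real.abs_le_sqrt (by nlinarith)) (Real.sqrt_nonneg _)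

theorem IsTestFunction.smoothAbs_comp {η : EuclideanSpace ℝ (Fin N) → ℝ}
    (hη : IsTestFunction Ω η) {ε : ℝ} (hε : 0 < ε) :
    IsTestFunction Ω (smoothAbs ε ∘ η) :=
  ⟨(contDiff_smoothAbs hε).comp hη.smooth, hη.compact.comp_left (smoothAbs_zero hε),
    (tsupport_comp_subset (smoothAbs_zero hε) η).trans hη.support⟩

theorem IsTestFunction.norm_gradient_smoothAbs_le {η : EuclideanSpace ℝ (Fin N) → ℝ}
    (hη : IsTestFunction Ω η) {ε : ℝ} (hε : 0 < ε) (x : EuclideanSpace ℝ (Fin N)) :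
    ‖∇ (smoothAbs ε ∘ η) x‖ ≤ ‖∇ η x‖ := by
  obtain ⟨d, hd, hder⟩ := exists_hasDerivAt_smoothAbs hε (η x)
  have h := hder.comp_hasFDerivAt x (hη.differentiable x).hasFDerivAt
  rw [gradient, gradient, LinearIsometryEquiv.norm_map, LinearIsometryEquiv.norm_map, h.fderiv,
    norm_smul, Real.norm_eq_abs]
  exact mul_le_of_le_one_left (norm_nonneg _) hd

theorem norm_fstLp_le (f : JetL2 Ω) : ‖fstLp Ω f‖ ≤ ‖f‖ := by
  refine Lp.norm_le_norm_of_ae_le ?_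
  filter_upwards [coeFn_fstLp f] with x hx
  rw [hx]
  exact WithLp.norm_fst_le _ _

/-- The absolute value of a test function can be approximated by test functions of no larger
`H¹` norm. -/
theorem exists_testJets_near_abs {h : JetL2 Ω} (hh : h ∈ testJets Ω) {δ : ℝ} (hδ : 0 < δ) :
    ∃ h' ∈ testJets Ω, ‖h'‖ ≤ ‖h‖ ∧ ‖fstLp Ω h' - |fstLp Ω h|‖ ≤ δ := by
  obtain ⟨η, hη, hhη⟩ := hh
  have hK : MeasurableSet (tsupport η) := (isClosed_tsupport η).measurableSet
  have hKfin : volume.restrict Ω (tsupport η) ≠ ⊤ :=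
    (hη.compact.isCompact.measure_lt_top).ne
  set C : ℝ := (volume.restrict Ω).real (tsupport η) ^ (1 / (2 : ℝ≥0∞).toReal) with hC
  have hC0 : 0 ≤ C := by positivity
  set ε : ℝ := δ / (C + 1) with hεdef
  have hε : 0 < ε := by positivity
  have hη' := hη.smoothAbs_comp hε
  have hL : MemLp (jet (smoothAbs ε ∘ η) (∇ (smoothAbs ε ∘ η))) 2 (volume.restrict Ω) :=
    memLp_jet hη'.memLp hη'.memLp_gradient
  refine ⟨hL.toLp, ⟨_, hη', hL.coeFn_toLp⟩, Lp.norm_le_norm_of_ae_le ?_, ?_⟩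
  · filter_upwards [hL.coeFn_toLp, hhη] with x h1 h2
    rw [h1, h2]
    refine le_of_sq_le_sq ?_ (norm_nonneg _)
    rw [WithLp.prod_norm_sq_eq_of_L2, WithLp.prod_norm_sq_eq_of_L2]
    refine add_le_add (pow_le_pow_left₀ (norm_nonneg _) ?_ 2)
      (pow_le_pow_left₀ (norm_nonneg _) (hη.norm_gradient_smoothAbs_le hε x) 2)
    change |smoothAbs ε (η x)| ≤ |η x|
    rw [abs_of_nonneg (smoothAbs_nonneg _ _)]
    exact smoothAbs_le_abs hε _
  · -- The two functions differ by at most `ε`, and only on the support of `η`.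
    have hle : ‖fstLp Ω hL.toLp - |fstLp Ω h|‖ ≤ ‖indicatorConstLp 2 hK hKfin ε‖ := by
      refine Lp.norm_le_norm_of_ae_le ?_
      filter_upwards [Lp.coeFn_sub (fstLp Ω hL.toLp) |fstLp Ω h|, coeFn_fstLp hL.toLp,
        hL.coeFn_toLp, Lp.coeFn_abs (fstLp Ω h), coeFn_fstLp h, hhη,
        indicatorConstLp_coeFn (p := 2) (hs := hK) (hμs := hKfin) (c := ε)]
        with x h1 h2 h3 h4 h5 h6 h7
      rw [h1, Pi.sub_apply, h2, h3, h4, h5, h6, h7]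
      change ‖smoothAbs ε (η x) - |η x|‖ ≤ _
      by_cases hx : x ∈ tsupport η
      · rw [indicator_of_mem hx, Real.norm_eq_abs, Real.norm_eq_abs, abs_of_pos hε, abs_sub_comm,
          abs_of_nonneg (sub_nonneg.2 (smoothAbs_le_abs hε _))]
        exact abs_sub_smoothAbs_le _ _
      · rw [indicator_of_notMem hx, image_eq_zero_of_notMem_tsupport hx, smoothAbs_zero hε]
        simp
    refine hle.trans ?_
    rw [norm_indicatorConstLp (by norm_num) (by norm_num), ← hC, Real.norm_eq_abs, abs_of_pos hε,
      hεdef, div_mul_eq_mul_div, div_le_iff₀ (by positivity)]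
    nlinarith

/-- `H¹₀(Ω)` is stable under absolute values, and these do not increase the norm. The absolute
value is the common point of the closed convex sets of elements of `H¹₀(Ω)` that are close to it
in `L²` and have almost the right norm. -/
theorem exists_abs_mem_sobolevZero {f : JetL2 Ω} (hf : f ∈ sobolevZero Ω) :
    ∃ f' ∈ sobolevZero Ω, fstLp Ω f' = |fstLp Ω f| ∧ ‖f'‖ ≤ ‖f‖ := by
  let δ : ℕ → ℝ := fun n => 1 / ((n : ℝ) + 1)
  have hδ : ∀ n, 0 < δ n := fun n => by positivity
  have hδanti : Antitone δ := fun m n hmn => one_div_le_one_div_of_le (by positivity) (by gcongr)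
  have hδlim : Tendsto δ atTop (𝓝 0) := tendsto_one_div_add_atTop_nhds_zero_nat
  let K : ℕ → Set (JetL2 Ω) := fun n => (sobolevZero Ω : Set (JetL2 Ω)) ∩
    ((fstLp Ω ⁻¹' Metric.closedBall |fstLp Ω f| (δ n)) ∩ Metric.closedBall 0 (‖f‖ + δ n))
  obtain ⟨f', hf'⟩ : (⋂ n, K n).Nonempty := by
    refine nonempty_iInter_of_antitone_convex (c := ‖f‖ + δ 0) (fun m n hmn => ?_) (fun n => ?_)
      (fun n => ?_) (fun n => ?_) (fun n x hx => ?_)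
    · refine inter_subset_inter_right _ (inter_subset_inter (preimage_mono ?_) ?_)
      · exact Metric.closedBall_subset_closedBall (hδanti hmn)
      · exact Metric.closedBall_subset_closedBall (by gcongr; exact hδanti hmn)
    · exact isClosed_sobolevZero.inter
        ((Metric.isClosed_closedBall.preimage (fstLp Ω).continuous).inter
          Metric.isClosed_closedBall)
    · exact (sobolevZero Ω).convex.inter
        (((convex_closedBall _ _).linear_preimage (fstLp Ω).toLinearMap).inter
          (convex_closedBall _ _))
    · obtain ⟨h, hh, hfh⟩ := Metric.mem_closure_iff.1
        (show f ∈ closure (testJets Ω : Set (JetL2 Ω)) from hf) (δ n / 2) (half_pos (hδ n))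
      obtain ⟨h', hh', hle, hnear⟩ := exists_testJets_near_abs hh (half_pos (hδ n))
      rw [dist_eq_norm] at hfh
      refine ⟨h', (testJets Ω).le_topologicalClosure hh', ?_, ?_⟩
      · rw [mem_preimage, mem_closedBall_iff_norm]
        calc ‖fstLp Ω h' - |fstLp Ω f|‖
            ≤ ‖fstLp Ω h' - |fstLp Ω h|‖ + ‖|fstLp Ω h| - |fstLp Ω f|‖ :=
              norm_sub_le_norm_sub_add_norm_sub _ _ _
          _ ≤ δ n / 2 + ‖fstLp Ω h - fstLp Ω f‖ := add_le_add hnear (norm_abs_sub_abs _ _)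
          _ ≤ δ n / 2 + δ n / 2 := by
              gcongr
              rw [← map_sub]
              exact (norm_fstLp_le _).trans (by rw [norm_sub_rev]; exact hfh.le)
          _ = δ n := add_halves _
      · rw [mem_closedBall_zero_iff]
        have h1 : ‖h‖ ≤ ‖f‖ + ‖f - h‖ := by
          rw [norm_sub_rev]
          exact norm_le_norm_add_norm_sub' h f
        linarith [hδ n]
    · exact (mem_closedBall_zero_iff.1 hx.2.2).trans (by gcongr; exact hδanti (Nat.zero_le n))
  rw [mem_iInter] at hf'
  refine ⟨f', (hf' 0).1, ?_, ?_⟩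
  · rw [← sub_eq_zero, ← norm_le_zero_iff]
    exact ge_of_tendsto' hδlim fun n => mem_closedBall_iff_norm.1 (hf' n).2.1
  · have h2 : Tendsto (fun n => ‖f‖ + δ n) atTop (𝓝 ‖f‖) := by
      simpa using tendsto_const_nhds.add hδlim
    exact ge_of_tendsto' h2 fun n => mem_closedBall_zero_iff.1 (hf' n).2.2

/-- The elements of `H¹₀(Ω)` that are at least `1` almost everywhere in `U`. -/
def admissible (Ω U : Set (EuclideanSpace ℝ (Fin N))) : Set (JetL2 Ω) :=
  {f | f ∈ sobolevZero Ω ∧ ∀ᵐ x ∂volume.restrict U, 1 ≤ (f x).fst}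

/-- The maximum and the minimum of two elements of `H¹₀(Ω)`, written as the half sum plus or minus
the absolute value of the half difference. The estimate is what makes the capacity strongly
subadditive; it needs no formula for the gradients. -/
theorem exists_admissible_union_inter {U V : Set (EuclideanSpace ℝ (Fin N))} (hU : U ⊆ Ω)
    (hV : V ⊆ Ω) {f h : JetL2 Ω} (hf : f ∈ admissible Ω U) (hh : h ∈ admissible Ω V) :
    ∃ M ∈ admissible Ω (U ∪ V), ∃ m ∈ admissible Ω (U ∩ V),
      ‖M‖ₑ ^ 2 + ‖m‖ₑ ^ 2 ≤ ‖f‖ₑ ^ 2 + ‖h‖ₑ ^ 2 := by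
  set a : JetL2 Ω := (2 : ℝ)⁻¹ • (f + h) with ha
  set b : JetL2 Ω := (2 : ℝ)⁻¹ • (f - h) with hb
  have haS : a ∈ sobolevZero Ω := (sobolevZero Ω).smul_mem _ ((sobolevZero Ω).add_mem hf.1 hh.1)
  have hbS : b ∈ sobolevZero Ω := (sobolevZero Ω).smul_mem _ ((sobolevZero Ω).sub_mem hf.1 hh.1)
  obtain ⟨b', hb'S, hb'abs, hb'le⟩ := exists_abs_mem_sobolevZero hbS
  have hval : ∀ᵐ x ∂volume.restrict Ω, ((a + b') x).fst = max (f x).fst (h x).fst ∧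
      ((a - b') x).fst = min (f x).fst (h x).fst := by
    have h7 := coeFn_fstLp b'
    rw [hb'abs] at h7
    filter_upwards [Lp.coeFn_add a b', Lp.coeFn_sub a b', Lp.coeFn_smul (2 : ℝ)⁻¹ (f + h),
      Lp.coeFn_smul (2 : ℝ)⁻¹ (f - h), Lp.coeFn_add f h, Lp.coeFn_sub f h, h7,
      Lp.coeFn_abs (fstLp Ω b), coeFn_fstLp b] with x h1 h2 h3 h4 h5 h6 h7 h8 h9
    have hax : (a x).fst = 2⁻¹ * ((f x).fst + (h x).fst) := by
      rw [ha, h3, Pi.smul_apply, h5]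
      rfl
    have hbx : (b x).fst = 2⁻¹ * ((f x).fst - (h x).fst) := by
      rw [hb, h4, Pi.smul_apply, h6]
      rfl
    have hb'x : (b' x).fst = 2⁻¹ * |(f x).fst - (h x).fst| := by
      rw [← h7, h8, h9, hbx, abs_mul]
      norm_num
    rw [h1, h2, Pi.add_apply, Pi.sub_apply, WithLp.add_fst, WithLp.sub_fst, hax, hb'x]
    rcases le_total (f x).fst (h x).fst with hle | hle
    · rw [max_eq_right hle, min_eq_left hle, abs_of_nonpos (sub_nonpos.2 hle)]
      constructor <;> ring
    · rw [max_eq_left hle, min_eq_right hle, abs_of_nonneg (sub_nonneg.2 hle)]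
      constructor <;> ring
  have hres : ∀ {W : Set (EuclideanSpace ℝ (Fin N))}, W ⊆ Ω →
      ∀ {p : EuclideanSpace ℝ (Fin N) → Prop}, (∀ᵐ x ∂volume.restrict Ω, p x) →
        ∀ᵐ x ∂volume.restrict W, p x :=
    fun hW _ hp => ae_mono (Measure.restrict_mono hW le_rfl) hp
  refine ⟨a + b', ⟨(sobolevZero Ω).add_mem haS hb'S, ?_⟩, a - b',
    ⟨(sobolevZero Ω).sub_mem haS hb'S, ?_⟩, ?_⟩
  · rw [ae_restrict_union_iff]
    constructor
    · filter_upwards [hres hU hval, hf.2] with x h1 h2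
      exact h1.1 ▸ le_max_of_le_left h2
    · filter_upwards [hres hV hval, hh.2] with x h1 h2
      exact h1.1 ▸ le_max_of_le_right h2
  · filter_upwards [hres (inter_subset_left.trans hU) hval,
      ae_mono (Measure.restrict_mono inter_subset_left le_rfl) hf.2,
      ae_mono (Measure.restrict_mono inter_subset_right le_rfl) hh.2] with x h1 h2 h3
    exact h1.2 ▸ le_min h2 h3
  · -- The parallelogram identity is used for `a ± b'` and for `f = a + b`, `h = a - b`.
    have hreal : ‖a + b'‖ ^ 2 + ‖a - b'‖ ^ 2 ≤ ‖f‖ ^ 2 + ‖h‖ ^ 2 := by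
      have e1 := parallelogram_law_with_norm ℝ a b'
      have e2 := parallelogram_law_with_norm ℝ a b
      have e3 : a + b = f := by rw [ha, hb]; module
      have e4 : a - b = h := by rw [ha, hb]; module
      rw [e3, e4] at e2
      have e5 := pow_le_pow_left₀ (norm_nonneg _) hb'le 2
      nlinarith
    simp only [← ofReal_norm, ← ENNReal.ofReal_pow (norm_nonneg _)]
    rw [← ENNReal.ofReal_add (by positivity) (by positivity),
      ← ENNReal.ofReal_add (by positivity) (by positivity)]
    exact ENNReal.ofReal_le_ofReal hreal

theorem convex_admissible {U : Set (EuclideanSpace ℝ (Fin N))} (hU : U ⊆ Ω) :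
    Convex ℝ (admissible Ω U) := by
  intro f hf h hh a b ha hb hab
  refine ⟨(sobolevZero Ω).convex hf.1 hh.1 ha hb hab, ?_⟩
  have hval : ∀ᵐ x ∂volume.restrict Ω,
      ((a • f + b • h : JetL2 Ω) x).fst = a * (f x).fst + b * (h x).fst := by
    filter_upwards [Lp.coeFn_add (a • f) (b • h), Lp.coeFn_smul a f, Lp.coeFn_smul b h]
      with x h1 h2 h3
    rw [h1, Pi.add_apply, h2, h3]
    rfl
  filter_upwards [ae_mono (Measure.restrict_mono hU le_rfl) hval, hf.2, hh.2] with x h1 h2 h3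
  rw [h1]
  nlinarith

theorem isClosed_admissible {U : Set (EuclideanSpace ℝ (Fin N))} (hU : U ⊆ Ω) :
    IsClosed (admissible Ω U) := by
  refine IsSeqClosed.isClosed fun f g hf hlim => ⟨?_, ?_⟩
  · exact isClosed_sobolevZero.mem_of_tendsto hlim (Eventually.of_forall fun n => (hf n).1)
  · obtain ⟨k, -, hk⟩ := (tendstoInMeasure_of_tendsto_Lp hlim).exists_seq_tendsto_ae
    filter_upwards [ae_mono (Measure.restrict_mono hU le_rfl) hk,
      ae_all_iff.2 fun n => (hf n).2] with x h1 h2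
    exact ge_of_tendsto' (((WithLp.fstL 2 ℝ ℝ (EuclideanSpace ℝ (Fin N))).continuous.tendsto
      (g x)).comp h1) fun n => h2 (k n)

/-! ### Properties of the capacity -/

theorem cap_le_enorm_sq {E U : Set (EuclideanSpace ℝ (Fin N))} (hUo : IsOpen U) (hEU : E ⊆ U)
    (hU : U ⊆ Ω) {f : JetL2 Ω} (hf : f ∈ admissible Ω U) : cap Ω E ≤ ‖f‖ₑ ^ 2 :=
  sInf_le ⟨_, _, memH10_of_mem_sobolevZero hf.1, ⟨U, hUo, hEU, hU, hf.2⟩,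
    (h1NormSq_eq_enorm_sq (Eventually.of_forall fun _ => rfl)).symm⟩

theorem exists_admissible_of_cap_lt {E : Set (EuclideanSpace ℝ (Fin N))} {c : ℝ≥0∞}
    (h : cap Ω E < c) : ∃ U, IsOpen U ∧ E ⊆ U ∧ U ⊆ Ω ∧ ∃ f ∈ admissible Ω U, ‖f‖ₑ ^ 2 < c := by
  obtain ⟨_, ⟨z, g, hz, ⟨U, hUo, hEU, hU, hzU⟩, rfl⟩, hc⟩ := sInf_lt_iff.1 h
  obtain ⟨f, hf, hfz⟩ := hz.exists_mem_sobolevZero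
  refine ⟨U, hUo, hEU, hU, f, ⟨hf, ?_⟩, by rwa [← h1NormSq_eq_enorm_sq hfz]⟩
  filter_upwards [ae_mono (Measure.restrict_mono hU le_rfl) hfz, hzU] with x h1 h2
  rw [h1]
  exact h2

theorem cap_mono {E F : Set (EuclideanSpace ℝ (Fin N))} (h : E ⊆ F) : cap Ω E ≤ cap Ω F :=
  sInf_le_sInf fun _ ⟨z, g, hz, ⟨U, hUo, hFU, hU, hzU⟩, hc⟩ =>
    ⟨z, g, hz, ⟨U, hUo, h.trans hFU, hU, hzU⟩, hc⟩

theorem cap_union_le (E F : Set (EuclideanSpace ℝ (Fin N))) :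
    cap Ω (E ∪ F) ≤ cap Ω E + cap Ω F := by
  refine ENNReal.le_of_forall_pos_le_add fun r hr hlt => ?_
  have hr2 : ((r / 2 : NNReal) : ℝ≥0∞) ≠ 0 := ENNReal.coe_ne_zero.2 (half_pos hr).ne'
  have ha : cap Ω E < cap Ω E + (r / 2 : NNReal) :=
    ENNReal.lt_add_right (ENNReal.add_lt_top.1 hlt).1.ne hr2
  have hb : cap Ω F < cap Ω F + (r / 2 : NNReal) :=
    ENNReal.lt_add_right (ENNReal.add_lt_top.1 hlt).2.ne hr2
  obtain ⟨U, hUo, hEU, hU, f, hf, hfa⟩ := exists_admissible_of_cap_lt ha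
  obtain ⟨V, hVo, hFV, hV, h, hh, hhb⟩ := exists_admissible_of_cap_lt hb
  obtain ⟨M, hM, m, -, hle⟩ := exists_admissible_union_inter hU hV hf hh
  calc cap Ω (E ∪ F) ≤ ‖M‖ₑ ^ 2 :=
        cap_le_enorm_sq (hUo.union hVo) (union_subset_union hEU hFV) (union_subset hU hV) hM
    _ ≤ ‖M‖ₑ ^ 2 + ‖m‖ₑ ^ 2 := le_self_add
    _ ≤ ‖f‖ₑ ^ 2 + ‖h‖ₑ ^ 2 := hle
    _ ≤ (cap Ω E + (r / 2 : NNReal)) + (cap Ω F + (r / 2 : NNReal)) :=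
        add_le_add hfa.le hhb.le
    _ = cap Ω E + cap Ω F + r := by
        rw [add_add_add_comm, ← ENNReal.coe_add, add_halves]

/-- Increasing sets have increasing open neighbourhoods with almost optimal admissible functions.
These neighbourhoods are the partial unions of almost optimal ones, the functions are the
corresponding maxima. The errors only add up, because the minimum of the function for `n` and of
the one for `n + 1` is admissible for `E n`, so that `cap (E n)` can be subtracted in each step. -/
theorem exists_admissible_partialUnion {E : ℕ → Set (EuclideanSpace ℝ (Fin N))}
    (hmono : Monotone E) (hfin : ∀ n, cap Ω (E n) ≠ ⊤) {ε : ℕ → ℝ≥0∞} (hε : ∀ n, 0 < ε n) :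
    ∃ U : ℕ → Set (EuclideanSpace ℝ (Fin N)), Monotone U ∧ (∀ n, IsOpen (U n)) ∧
      (∀ n, E n ⊆ U n) ∧ (∀ n, U n ⊆ Ω) ∧ ∀ n, ∃ f ∈ admissible Ω (U n),
        ‖f‖ₑ ^ 2 ≤ cap Ω (E n) + ∑ k ∈ Finset.range (n + 1), ε k := by
  have h0 : ∀ n, ∃ V, IsOpen V ∧ E n ⊆ V ∧ V ⊆ Ω ∧
      ∃ f ∈ admissible Ω V, ‖f‖ₑ ^ 2 < cap Ω (E n) + ε n := fun n =>
    exists_admissible_of_cap_lt (ENNReal.lt_add_right (hfin n) (hε n).ne')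
  choose V hVo hEV hV f hf hfle using h0
  refine ⟨partialSups V, (partialSups V).monotone, fun n => ?_, fun n => ?_, fun n => ?_,
    fun n => ?_⟩
  · induction n with
    | zero => simpa using hVo 0
    | succ n ih => rw [partialSups_add_one]; exact ih.union (hVo _)
  · exact (hEV n).trans (le_partialSups V n)
  · exact partialSups_le V n Ω fun k _ => hV k
  · induction n with
    | zero => exact ⟨f 0, by simpa using hf 0, by simpa using (hfle 0).le⟩
    | succ n ih =>
      have hPo : IsOpen (partialSups V n) := by
        clear ih
        induction n with
        | zero => simpa using hVo 0
        | succ n ih => rw [partialSups_add_one]; exact ih.union (hVo _)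
      have hPΩ : partialSups V n ⊆ Ω := partialSups_le V n Ω fun k _ => hV k
      obtain ⟨g, hg, hgle⟩ := ih
      obtain ⟨M, hM, m, hm, hle⟩ := exists_admissible_union_inter hPΩ (hV (n + 1)) hg (hf (n + 1))
      refine ⟨M, by rw [partialSups_add_one]; exact hM, ?_⟩
      have hcap : cap Ω (E n) ≤ ‖m‖ₑ ^ 2 :=
        cap_le_enorm_sq (hPo.inter (hVo _))
          (subset_inter ((hEV n).trans (le_partialSups V n))
            ((hmono n.le_succ).trans (hEV _))) (inter_subset_left.trans hPΩ) hm
      refine (ENNReal.add_le_add_iff_right (hfin n)).1 ?_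
      calc ‖M‖ₑ ^ 2 + cap Ω (E n) ≤ ‖M‖ₑ ^ 2 + ‖m‖ₑ ^ 2 := by gcongr
        _ ≤ ‖g‖ₑ ^ 2 + ‖f (n + 1)‖ₑ ^ 2 := hle
        _ ≤ (cap Ω (E n) + ∑ k ∈ Finset.range (n + 1), ε k) +
            (cap Ω (E (n + 1)) + ε (n + 1)) := add_le_add hgle (hfle _).le
        _ = cap Ω (E (n + 1)) + ∑ k ∈ Finset.range (n + 1 + 1), ε k + cap Ω (E n) := by
            rw [Finset.sum_range_succ _ (n + 1)]
            ring

/-- The capacity is continuous along increasing sequences of arbitrary sets. -/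
theorem cap_iUnion_le_of_monotone {E : ℕ → Set (EuclideanSpace ℝ (Fin N))} (hmono : Monotone E)
    {c : ℝ≥0∞} (hc : ∀ n, cap Ω (E n) ≤ c) : cap Ω (⋃ n, E n) ≤ c := by
  rcases eq_or_ne c ⊤ with rfl | hctop
  · exact le_top
  refine ENNReal.le_of_forall_pos_le_add fun r hr _ => ?_
  obtain ⟨ε, hε, hsum⟩ := ENNReal.exists_pos_sum_of_countable' (ENNReal.coe_pos.2 hr).ne' ℕ
  obtain ⟨U, hUmono, hUo, hEU, hU, hf⟩ := exists_admissible_partialUnion hmono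
    (fun n => ne_top_of_le_ne_top hctop (hc n)) hε
  set d : ℝ≥0∞ := c + r with hd
  have hdtop : d ≠ ⊤ := ENNReal.add_ne_top.2 ⟨hctop, ENNReal.coe_ne_top⟩
  have hball : ∀ f : JetL2 Ω, ‖f‖ₑ ^ 2 ≤ d ↔ f ∈ Metric.closedBall 0 √d.toReal := fun f => by
    rw [mem_closedBall_zero_iff, Real.le_sqrt (norm_nonneg _) ENNReal.toReal_nonneg, ← ofReal_norm,
      ← ENNReal.ofReal_pow (norm_nonneg _), ENNReal.ofReal_le_iff_le_toReal hdtop]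
  obtain ⟨f, hfmem⟩ : (⋂ n, admissible Ω (U n) ∩ Metric.closedBall 0 √d.toReal).Nonempty := by
    refine nonempty_iInter_of_antitone_convex (c := √d.toReal) (fun m n hmn => ?_)
      (fun n => (isClosed_admissible (hU n)).inter Metric.isClosed_closedBall)
      (fun n => (convex_admissible (hU n)).inter (convex_closedBall _ _)) (fun n => ?_)
      (fun n x hx => mem_closedBall_zero_iff.1 hx.2)
    · exact inter_subset_inter_left _ fun f hf =>
        ⟨hf.1, ae_mono (Measure.restrict_mono (hUmono hmn) le_rfl) hf.2⟩
    · obtain ⟨f, hf, hle⟩ := hf n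
      refine ⟨f, hf, (hball f).1 (hle.trans (add_le_add (hc n) ?_))⟩
      exact (ENNReal.sum_le_tsum _).trans hsum.le
  rw [mem_iInter] at hfmem
  refine (cap_le_enorm_sq (isOpen_iUnion hUo) (iUnion_mono hEU) (iUnion_subset hU) (f := f)
    ⟨(hfmem 0).1.1, ?_⟩).trans ((hball f).2 (hfmem 0).2)
  rw [ae_restrict_iUnion_iff]
  exact fun n => (hfmem n).1.2

theorem cap_iUnion_eq_zero {ι : Type*} [Countable ι] [Nonempty ι]
    {E : ι → Set (EuclideanSpace ℝ (Fin N))} (h : ∀ i, cap Ω (E i) = 0) :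
    cap Ω (⋃ i, E i) = 0 := by
  obtain ⟨e, he⟩ := exists_surjective_nat ι
  have hps : ∀ n, cap Ω (partialSups (E ∘ e) n) = 0 := by
    intro n
    induction n with
    | zero => simpa using h (e 0)
    | succ n ih =>
      rw [partialSups_add_one, ← nonpos_iff_eq_zero]
      exact (cap_union_le _ _).trans (by rw [ih, Function.comp_apply, h, add_zero])
  rw [← nonpos_iff_eq_zero, ← he.iUnion_comp]
  exact (cap_mono (iUnion_mono fun n => le_partialSups (E ∘ e) n)).trans
    (cap_iUnion_le_of_monotone (partialSups (E ∘ e)).monotone fun n => (hps n).le)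

/-! ### Comparison of two limits -/

/-- The superlevel sets of two limits of the same sequence compare on compact sets: pass through the
superlevel sets of the sequence at an intermediate level and on an intermediate set. -/
theorem cap_superlevel_inter_le (hΩ : IsOpen Ω)
    {ψn : ℕ → EuclideanSpace ℝ (Fin N) → EReal} {ψ φ : EuclideanSpace ℝ (Fin N) → EReal}
    (hψ : LevTendsto Ω ψn ψ) (hφ : LevTendsto Ω ψn φ) {s t : ℝ} (hst : s < t)
    {K U : Set (EuclideanSpace ℝ (Fin N))} (hK : IsCompact K) (hU : IsOpen U) (hKU : K ⊆ U)
    (hUΩ : U ⊆ Ω) : cap Ω (superlevel Ω ψ t ∩ K) ≤ cap Ω (superlevel Ω φ s ∩ U) := by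
  obtain ⟨r, hsr, hrt⟩ := exists_between hst
  obtain ⟨L, hL, hKL, hLU⟩ := exists_compact_between hK hU hKU
  obtain ⟨L', hL', hLL', hL'U⟩ := exists_compact_between hL hU hLU
  have hin : ∀ {A B : Set (EuclideanSpace ℝ (Fin N))}, IsCompact A → A ⊆ interior B →
      CompactlyIn A B := fun hA hAB =>
    ⟨by rwa [hA.isClosed.closure_eq], by rwa [hA.isClosed.closure_eq]⟩
  have hinΩ : ∀ {A : Set (EuclideanSpace ℝ (Fin N))}, IsCompact A → A ⊆ U → CompactlyIn A Ω :=
    fun hA hAU => hin hA (by rw [hΩ.interior_eq]; exact hAU.trans hUΩ)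
  calc cap Ω (superlevel Ω ψ t ∩ K)
      ≤ liminf (fun n => cap Ω (superlevel Ω (ψn n) r ∩ L)) atTop :=
        (hψ r t hrt K L (hin hK hKL) (hinΩ hL hLU)).1
    _ ≤ limsup (fun n => cap Ω (superlevel Ω (ψn n) r ∩ L)) atTop := liminf_le_limsup
    _ ≤ cap Ω (superlevel Ω φ s ∩ L') := (hφ s r hsr L L' (hin hL hLL') (hinΩ hL' hL'U)).2
    _ ≤ cap Ω (superlevel Ω φ s ∩ U) := cap_mono (inter_subset_inter_right _ hL'U)

/-- If `φ` is quasi upper semicontinuous and the capacity of `{φ > s}` locally dominates that of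
`{ψ > t}`, then `φ < s` and `t < ψ` hold together only on a null set. Off a set `E` of small
capacity, `φ < s` persists near each point, so that `{φ > s}` lies inside `E` on an open set `U`. An
exhaustion of `U` by compact sets bounds the capacity of `{ψ > t}` in `U` by that of `E`. -/
theorem cap_superlevel_inter_lt_eq_zero (hΩ : IsOpen Ω)
    {ψ φ : EuclideanSpace ℝ (Fin N) → EReal} (hφ : QuasiUSC Ω φ) {s t : ℝ}
    (hle : ∀ K U : Set (EuclideanSpace ℝ (Fin N)), IsCompact K → IsOpen U → K ⊆ U → U ⊆ Ω →
      cap Ω (superlevel Ω ψ t ∩ K) ≤ cap Ω (superlevel Ω φ s ∩ U)) :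
    cap Ω {x ∈ Ω | (t : EReal) < ψ x ∧ φ x < s} = 0 := by
  rw [← nonpos_iff_eq_zero]
  refine ENNReal.le_of_forall_pos_le_add fun r hr _ => ?_
  obtain ⟨E, -, hE, husc⟩ := hφ (r / 2 : NNReal) (ENNReal.coe_pos.2 (half_pos hr))
  set U : Set (EuclideanSpace ℝ (Fin N)) := {x | ∀ᶠ y in 𝓝 x, y ∈ Ω ∧ (y ∉ E → φ y < s)}
  have hUo : IsOpen U := isOpen_iff_mem_nhds.2 fun x hx => eventually_eventually_nhds.2 hx
  have hU : ∀ x ∈ U, x ∈ Ω ∧ (x ∉ E → φ x < s) := fun x hx =>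
    Eventually.self_of_nhds (p := fun y => y ∈ Ω ∧ (y ∉ E → φ y < s)) hx
  have hUΩ : U ⊆ Ω := fun x hx => (hU x hx).1
  have hsub : {x ∈ Ω | (t : EReal) < ψ x ∧ φ x < s} ⊆ (superlevel Ω ψ t ∩ U) ∪ E := by
    rintro x ⟨hxΩ, hxt, hxs⟩
    by_cases hxE : x ∈ E
    · exact Or.inr hxE
    · refine Or.inl ⟨⟨hxΩ, hxt⟩, ?_⟩
      have h1 := eventually_nhdsWithin_iff.1 (husc x ⟨hxΩ, hxE⟩ s hxs)
      filter_upwards [h1, hΩ.mem_nhds hxΩ] with y hy hyΩ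
      exact ⟨hyΩ, fun hyE => hy ⟨hyΩ, hyE⟩⟩
  have hUcap : cap Ω (superlevel Ω ψ t ∩ U) ≤ cap Ω E := by
    obtain ⟨F, hFmono, hFclosed, hFU⟩ : ∃ F : ℕ → Set (EuclideanSpace ℝ (Fin N)),
        Monotone F ∧ (∀ n, IsClosed (F n)) ∧ ⋃ n, F n = U := by
      obtain ⟨F, h1, -, h2, h3⟩ := hUo.exists_iUnion_isClosed
      exact ⟨F, h3, h1, h2⟩
    let K : ℕ → Set (EuclideanSpace ℝ (Fin N)) := fun n => F n ∩ Metric.closedBall 0 n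
    have hKmono : Monotone K := fun m n hmn => inter_subset_inter (hFmono hmn)
      (Metric.closedBall_subset_closedBall (by exact_mod_cast hmn))
    have hKU : ∀ n, K n ⊆ U := fun n =>
      inter_subset_left.trans (hFU ▸ subset_iUnion F n)
    have hcover : U ⊆ ⋃ n, K n := by
      intro x hx
      rw [← hFU] at hx
      obtain ⟨m, hm⟩ := mem_iUnion.1 hx
      obtain ⟨n, hn⟩ := exists_nat_ge ‖x‖
      refine mem_iUnion.2 ⟨max m n, hFmono (le_max_left _ _) hm, mem_closedBall_zero_iff.2 ?_⟩
      exact hn.trans (by exact_mod_cast le_max_right m n)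
    have hφE : superlevel Ω φ s ∩ U ⊆ E := by
      rintro x ⟨⟨-, hxs⟩, hxU⟩
      by_contra hxE
      exact lt_asymm hxs ((hU x hxU).2 hxE)
    refine (cap_mono (F := ⋃ n, superlevel Ω ψ t ∩ K n) ?_).trans
      (cap_iUnion_le_of_monotone (fun m n hmn => inter_subset_inter_right _ (hKmono hmn))
        fun n => (hle (K n) U ?_ hUo (hKU n) hUΩ).trans (cap_mono hφE))
    · rw [← inter_iUnion]
      exact inter_subset_inter_right _ hcover
    · exact (isCompact_closedBall 0 (n : ℝ)).inter_left (hFclosed n)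
  calc cap Ω {x ∈ Ω | (t : EReal) < ψ x ∧ φ x < s}
      ≤ cap Ω (superlevel Ω ψ t ∩ U) + cap Ω E := (cap_mono hsub).trans (cap_union_le _ _)
    _ ≤ (r / 2 : NNReal) + (r / 2 : NNReal) := add_le_add (hUcap.trans hE.le) hE.le
    _ = 0 + r := by rw [← ENNReal.coe_add, add_halves, zero_add]

/-- Of two limits of the same sequence, the one that is quasi upper semicontinuous is quasi
everywhere at least as large as the other. -/
theorem cap_lt_eq_zero (hΩ : IsOpen Ω)
    {ψn : ℕ → EuclideanSpace ℝ (Fin N) → EReal} {ψ φ : EuclideanSpace ℝ (Fin N) → EReal}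
    (hφusc : QuasiUSC Ω φ) (hψ : LevTendsto Ω ψn ψ) (hφ : LevTendsto Ω ψn φ) :
    cap Ω {x ∈ Ω | φ x < ψ x} = 0 := by
  rw [← nonpos_iff_eq_zero]
  refine (cap_mono (F := ⋃ q : {q : ℚ × ℚ // q.1 < q.2},
    {x ∈ Ω | (((q.1.2 : ℚ) : ℝ) : EReal) < ψ x ∧ φ x < ((q.1.1 : ℚ) : ℝ)}) ?_).trans ?_
  · rintro x ⟨hxΩ, hx⟩
    obtain ⟨t, ht1, ht2⟩ := EReal.lt_iff_exists_rat_btwn.1 hx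
    obtain ⟨s, hs1, hs2⟩ := EReal.lt_iff_exists_rat_btwn.1 ht1
    exact mem_iUnion.2 ⟨⟨(s, t), by exact_mod_cast hs2⟩, hxΩ, ht2, hs1⟩
  · have : Nonempty {q : ℚ × ℚ // q.1 < q.2} := ⟨⟨(0, 1), zero_lt_one⟩⟩
    refine (cap_iUnion_eq_zero fun q => ?_).le
    exact cap_superlevel_inter_lt_eq_zero hΩ hφusc fun K U hK hU hKU hUΩ =>
      cap_superlevel_inter_le hΩ hψ hφ (by exact_mod_cast q.2) hK hU hKU hUΩ

end LevelSetConv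

theorem proposition3p5 {N : ℕ} (hN : 1 ≤ N) (Ω : Set (EuclideanSpace ℝ (Fin N)))
    (hΩ : IsOpen Ω)
    (ψn : ℕ → EuclideanSpace ℝ (Fin N) → EReal) (ψ φ : EuclideanSpace ℝ (Fin N) → EReal)
    (hψn : ∀ n, LevelSetConv.QuasiUSC Ω (ψn n))
    (hψ : LevelSetConv.QuasiUSC Ω ψ) (hφ : LevelSetConv.QuasiUSC Ω φ)
    (hconvψ : LevelSetConv.LevTendsto Ω ψn ψ) (hconvφ : LevelSetConv.LevTendsto Ω ψn φ) :
    LevelSetConv.cap Ω {x ∈ Ω | ψ x ≠ φ x} = 0 := by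
  rw [← nonpos_iff_eq_zero]
  calc LevelSetConv.cap Ω {x ∈ Ω | ψ x ≠ φ x}
      ≤ LevelSetConv.cap Ω ({x ∈ Ω | ψ x < φ x} ∪ {x ∈ Ω | φ x < ψ x}) :=
        LevelSetConv.cap_mono fun x hx =>
          (lt_or_gt_of_ne hx.2).imp (fun h => ⟨hx.1, h⟩) fun h => ⟨hx.1, h⟩
    _ ≤ LevelSetConv.cap Ω {x ∈ Ω | ψ x < φ x} + LevelSetConv.cap Ω {x ∈ Ω | φ x < ψ x} :=
        LevelSetConv.cap_union_le _ _
    _ = 0 := by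
        rw [LevelSetConv.cap_lt_eq_zero hΩ hψ hconvφ hconvψ,
          LevelSetConv.cap_lt_eq_zero hΩ hφ hconvψ hconvφ, add_zero]
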